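/- **Setting.** Let $X\subset\mathbb R$ be a nonempty compact set of outputs (for instance a finite set or a compact interval) and let $\Delta(X)$ be the set of Borel probability measures on $X$ with the weak$^*$ topology (weak convergence of measures). Types lie in $\Theta=[\underline\theta,\overline\theta]$. Let $u:\mathbb R\to\mathbb R$ be strictly increasing, continuous and concave. The cost $C:\Theta\times\Delta(X)\to\mathbb R$ is bounded, and $C(\theta,\cdot)$ is weak$^*$-continuous and convex for every $\theta$. In addition: * $C(\theta,\cdot)$ is increasing in first-order stochastic dominance; * $C(\theta,\cdot)$ is Gâteaux differentiable: for all $(\theta,\mu)$ there is a continuous $c_\mu(\theta,\cdot):X\to\mathbb R$ with $\lim_{\varepsilon\searrow0}\frac{C(\theta,(1-\varepsilon)\mu+\varepsilon\mu')-C(\theta,\mu)}{\varepsilon}=\int_X c_\mu(\theta,x)\,[\mu'-\mu](dx)$ for all $\mu'\in\Delta(X)$; * $C(\cdot,\mu)$ is strictly decreasing and continuously differentiable for every $\mu$ (with one-sided derivatives at the end points), and $\sup_{\mu\in\Delta(X)}|\partial C(\theta,\mu)/\partial\theta|<\infty$ for every $\theta$. For a wage $w:X\to\mathbb R$ put $U(\theta,w,\mu)=\int_X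 u(w(x))\,\mu(dx)-C(\theta,\mu)$. A (direct) mechanism $\{w_\theta,\mu_\theta\}_{\theta\in\Theta}$ consists of non-decreasing right-continuous wages $w_\theta:X\to\mathbb R$ and of $\mu_\theta\in\Delta(X)$. It is *incentive compatible* if $U(\theta,w_\theta,\mu_\theta)\ge U(\theta,w_{\hat\theta},\mu')$ for all $\theta,\hat\theta\in\Theta$ and all $\mu'\in\Delta(X)$. Write $u^{-1}(y)=+\infty$ if $y$ lies above the range of $u$. **Theorem.** Let $\{w_\theta\}_{\theta\in\Theta}$ be non-decreasing and right-continuous wages. Then for all $\theta,\hat\theta\in\Theta$ the set $\arg\max_{\nu\in\Delta(X)}U(\theta,w_{\hat\theta},\nu)$ is nonempty. Moreover, a mechanism $\{w_\theta,\mu_\theta\}_{\theta\in\Theta}$ is incentive compatible if and only if there exist $\mu_{\theta,\hat\theta}\in\Delta(X)$ for $(\theta,\hat\theta)\in\Theta^2$ with $\mu_{\theta,\theta}=\mu_\theta$, and an absolutely continuous $V:\Theta\to\mathbb R$ with $V(\theta)=U(\theta,w_\theta,\mu_\theta)$, such that for all $\theta\in\Theta$ (the integrands in 1 and 2 being integrable):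 1. **Envelope:** $V(\theta)=V(\underline\theta)-\int_{\underline\theta}^{\theta}\frac{\partial C}{\partial\theta}(t,\mu_t)\,dt$; 2. **Generalized monotonicity:** $\int_{\hat\theta}^{\theta}\Big[-\frac{\partial C}{\partial\theta}(t,\mu_t)+\frac{\partial C}{\partial\theta}(t,\mu_{t,\hat\theta})\Big]dt\ge0$ for all $\hat\theta\in\Theta$; 3. **On-path obedience:** $w_\theta(x)\le u^{-1}\Big(c_{\mu_\theta}(\theta,x)+V(\theta)+C(\theta,\mu_\theta)-\int_X c_{\mu_\theta}(\theta,y)\,\mu_\theta(dy)\Big)$ for all $x\in X$, with equality for $\mu_\theta$-almost all $x$; 4. **Off-path obedience:** $\mu_{\theta,\hat\theta}\in\arg\max_{\nu\in\Delta(X)}\int_X\big[u(w_{\hat\theta}(x))-c_{\mu_{\theta,\hat\theta}}(\theta,x)\big]\,\nu(dx)$ for all $\hat\theta\in\Theta$ with $\hat\theta\ne\theta$. -/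

import Mathlib

open Set Filter Topology MeasureTheory

noncomputable section

namespace FlexMech

/-- The mixture `(1 - t) μ + t ν` of two probability measures, for `t ∈ [0, 1]`. -/
def mix {X : Type*} [MeasurableSpace X] (t : unitInterval) (μ ν : ProbabilityMeasure X) :
    ProbabilityMeasure X :=
  ⟨ENNReal.ofReal (1 - (t : ℝ)) • (μ : Measure X) + ENNReal.ofReal (t : ℝ) • (ν : Measure X), by
    refine ⟨?_⟩
    have h0 : 0 ≤ (t : ℝ) := t.2.1
    have h1 : 0 ≤ 1 - (t : ℝ) := sub_nonneg.2 t.2.2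
    simp only [Measure.coe_add, Measure.coe_smul, Pi.add_apply, Pi.smul_apply, measure_univ,
      smul_eq_mul, mul_one]
    rw [← ENNReal.ofReal_add h1 h0]
    simp⟩

variable {X : Set ℝ}

/-- `ν` first-order stochastically dominates `μ`: its cumulative distribution function is
everywhere below that of `μ`. -/
def FOSD (ν μ : ProbabilityMeasure X) : Prop :=
  ∀ t : ℝ, (ν : Measure X) {x : X | (x : ℝ) ≤ t} ≤ (μ : Measure X) {x : X | (x : ℝ) ≤ t}

/-- The continuous function `c` is a (one-sided) Gâteaux derivative at `μ` of the functional `K`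
on probability measures. -/
def IsGateauxDeriv (K : ProbabilityMeasure X → ℝ) (μ : ProbabilityMeasure X) (c : C(X, ℝ)) :
    Prop :=
  ∀ ν : ProbabilityMeasure X,
    Tendsto (fun ε : unitInterval => (K (mix ε μ ν) - K μ) / (ε : ℝ)) (𝓝[>] 0)
      (𝓝 ((∫ x, c x ∂(ν : Measure X)) - ∫ x, c x ∂(μ : Measure X)))

/-- The partial derivative `∂C(θ, μ)/∂θ`, one-sided at the end points of `[lo, hi]`. -/
def dCost (lo hi : ℝ) (C : ℝ → ProbabilityMeasure X → ℝ) (θ : ℝ) (μ : ProbabilityMeasure X) : ℝ :=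
  derivWithin (fun t => C t μ) (Icc lo hi) θ

/-- The standing assumptions on the cost `C(θ, μ)` for `θ ∈ [lo, hi]`, where `c θ μ` is the
Gâteaux derivative of `C(θ, ·)` at `μ`. -/
structure IsCost (lo hi : ℝ) (C : ℝ → ProbabilityMeasure X → ℝ)
    (c : ℝ → ProbabilityMeasure X → C(X, ℝ)) : Prop where
  /-- weak* continuity -/
  continuous : ∀ θ ∈ Icc lo hi, Continuous (C θ)
  convex : ∀ θ ∈ Icc lo hi, ∀ (t : unitInterval) (μ ν : ProbabilityMeasure X),
    C θ (mix t μ ν) ≤ (1 - (t : ℝ)) * C θ μ + (t : ℝ) * C θ ν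
  bounded : ∃ B : ℝ, ∀ θ ∈ Icc lo hi, ∀ μ, |C θ μ| ≤ B
  mono : ∀ θ ∈ Icc lo hi, ∀ μ ν : ProbabilityMeasure X, FOSD ν μ → C θ μ ≤ C θ ν
  gateaux : ∀ θ ∈ Icc lo hi, ∀ μ, IsGateauxDeriv (C θ) μ (c θ μ)
  strictAnti : ∀ μ, StrictAntiOn (fun θ => C θ μ) (Icc lo hi)
  contDiff : ∀ μ, ContDiffOn ℝ 1 (fun θ => C θ μ) (Icc lo hi)
  deriv_bounded : ∀ θ ∈ Icc lo hi, ∃ B : ℝ, ∀ μ, |dCost lo hi C θ μ| ≤ B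

/-- The expected utility of type `θ` who faces the wage `w` and chooses the distribution `μ`. -/
def U (u : ℝ → ℝ) (C : ℝ → ProbabilityMeasure X → ℝ) (θ : ℝ) (w : X → ℝ)
    (μ : ProbabilityMeasure X) : ℝ :=
  (∫ x, u (w x) ∂(μ : Measure X)) - C θ μ

/-- Non-decreasing, right-continuous wages (on a compact `X` these are automatically measurable and
bounded). -/
def IsWage (w : X → ℝ) : Prop :=
  Monotone w ∧ ∀ x, ContinuousWithinAt w (Ioi x) x

/-- Incentive compatibility, jointly in reports and actions. -/
def IncentiveCompatible (lo hi : ℝ) (u : ℝ → ℝ) (C : ℝ → ProbabilityMeasure X → ℝ)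
    (w : ℝ → X → ℝ) (μ : ℝ → ProbabilityMeasure X) : Prop :=
  ∀ θ ∈ Icc lo hi, ∀ θ' ∈ Icc lo hi, ∀ ν : ProbabilityMeasure X,
    U u C θ (w θ') ν ≤ U u C θ (w θ) (μ θ)

/-- The inverse of a strictly increasing continuous `u`, extended to all real `y`: it is `u⁻¹ y`
when `y` is in the range of `u`, and `⊤` (`⊥`) when `y` is above (below) the range. -/
def extInv (u : ℝ → ℝ) (y : ℝ) : EReal :=
  sSup ((fun r : ℝ => (r : EReal)) '' {r : ℝ | u r ≤ y})

/-- The envelope formula at `θ`; integrability of the integrand is part of the claim. -/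
def Envelope (lo hi : ℝ) (C : ℝ → ProbabilityMeasure X → ℝ) (μ : ℝ → ProbabilityMeasure X)
    (V : ℝ → ℝ) (θ : ℝ) : Prop :=
  IntervalIntegrable (fun t => dCost lo hi C t (μ t)) volume lo θ ∧
    V θ = V lo - ∫ t in lo..θ, dCost lo hi C t (μ t)

/-- Generalized monotonicity for the type `θ` and all reports `θ'`, where `M θ θ'` is recommended
to type `θ` who reports `θ'`; integrability of the integrand is part of the claim. -/
def GenMonotone (lo hi : ℝ) (C : ℝ → ProbabilityMeasure X → ℝ) (μ : ℝ → ProbabilityMeasure X)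
    (M : ℝ → ℝ → ProbabilityMeasure X) (θ : ℝ) : Prop :=
  ∀ θ' ∈ Icc lo hi,
    IntervalIntegrable (fun t => -dCost lo hi C t (μ t) + dCost lo hi C t (M t θ')) volume θ' θ ∧
      0 ≤ ∫ t in θ'..θ, (-dCost lo hi C t (μ t) + dCost lo hi C t (M t θ'))

/-- The argument of `u⁻¹` in the on-path obedience condition. -/
def obedienceLevel (C : ℝ → ProbabilityMeasure X → ℝ) (c : ℝ → ProbabilityMeasure X → C(X, ℝ))
    (μ : ℝ → ProbabilityMeasure X) (V : ℝ → ℝ) (θ : ℝ) (x : X) : ℝ :=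
  c θ (μ θ) x + V θ + C θ (μ θ) - ∫ y, c θ (μ θ) y ∂(μ θ : Measure X)

/-- On-path obedience of type `θ`. -/
def OnPathObedience (u : ℝ → ℝ) (C : ℝ → ProbabilityMeasure X → ℝ)
    (c : ℝ → ProbabilityMeasure X → C(X, ℝ)) (w : ℝ → X → ℝ) (μ : ℝ → ProbabilityMeasure X)
    (V : ℝ → ℝ) (θ : ℝ) : Prop :=
  (∀ x : X, (w θ x : EReal) ≤ extInv u (obedienceLevel C c μ V θ x)) ∧
    ∀ᵐ x ∂(μ θ : Measure X), (w θ x : EReal) = extInv u (obedienceLevel C c μ V θ x)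

/-- Off-path obedience of type `θ` after every misreport `θ'`. -/
def OffPathObedience (lo hi : ℝ) (u : ℝ → ℝ) (c : ℝ → ProbabilityMeasure X → C(X, ℝ))
    (w : ℝ → X → ℝ) (M : ℝ → ℝ → ProbabilityMeasure X) (θ : ℝ) : Prop :=
  ∀ θ' ∈ Icc lo hi, θ' ≠ θ → ∀ ν : ProbabilityMeasure X,
    ∫ x, (u (w θ' x) - c θ (M θ θ') x) ∂(ν : Measure X) ≤
      ∫ x, (u (w θ' x) - c θ (M θ θ') x) ∂(M θ θ' : Measure X)

end FlexMech

end

/-! For a fixed report the objective is linear minus convex in the distribution, so the first-order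
condition characterizes best responses (`forall_integral_sub_le_iff`). Off the path this is
condition 4. On the path, testing with Dirac measures makes it a pointwise bound that binds almost
surely, which is condition 3 (`onPathObedience_iff`).

The envelope formula holds for the truthful value and also for the best-response value under each
fixed wage. The two values agree at `θ'`; hence the integral in condition 2 is exactly what type `θ`
loses by reporting `θ'` (`IsCost.integral_eq_loss`), and its sign says that no misreport pays.

The bound on the cost derivative may depend on the type, so no dominating function is at hand.
Instead the value is shown to be continuous and monotone, and a Dini derivative bound at every point
excludes a singular part (`envelope_of_continuousOn`). -/

/-! ### Semicontinuity of integrals under weak convergence. -/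

/-- Layer cake formula, the portmanteau inequality on the open superlevel sets, and Fatou; first
countability reduces to sequences. -/
theorem lowerSemicontinuous_lintegral_ofReal {Ω : Type*} [MeasurableSpace Ω] [TopologicalSpace Ω]
    [OpensMeasurableSpace Ω] [HasOuterApproxClosed Ω] [FirstCountableTopology (ProbabilityMeasure Ω)]
    {f : Ω → ℝ} (hf : LowerSemicontinuous f) (hf0 : 0 ≤ f) :
    LowerSemicontinuous fun ν : ProbabilityMeasure Ω =>
      ∫⁻ x, ENNReal.ofReal (f x) ∂(ν : Measure Ω) := by
  intro ν y hy
  by_contra hcon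
  obtain ⟨νs, hνs, hle⟩ := exists_seq_forall_of_frequently (not_eventually.1 hcon)
  have key : ∫⁻ x, ENNReal.ofReal (f x) ∂(ν : Measure Ω) ≤
      atTop.liminf fun i => ∫⁻ x, ENNReal.ofReal (f x) ∂(νs i : Measure Ω) := by
    simp_rw [lintegral_eq_lintegral_meas_lt _ (Eventually.of_forall hf0) hf.measurable.aemeasurable]
    calc ∫⁻ (t : ℝ) in Ioi 0, (ν : Measure Ω) {a | t < f a}
        ≤ ∫⁻ (t : ℝ) in Ioi 0, atTop.liminf (fun i => (νs i : Measure Ω) {a | t < f a}) :=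
          lintegral_mono fun t =>
            ProbabilityMeasure.le_liminf_measure_open_of_tendsto hνs (hf.isOpen_preimage t)
      _ ≤ _ := lintegral_liminf_le fun n => Antitone.measurable fun s t hst =>
            measure_mono fun ω hω => lt_of_le_of_lt hst hω
  have h2 : (atTop.liminf fun i => ∫⁻ x, ENNReal.ofReal (f x) ∂(νs i : Measure Ω)) ≤ y :=
    liminf_le_of_le (by isBoundedDefault) fun b hb => by
      obtain ⟨i, hi⟩ := hb.exists
      exact hi.trans (not_lt.1 (hle i))
  exact absurd hy (not_lt.2 (key.trans h2))

theorem upperSemicontinuous_integral {Ω : Type*} [MeasurableSpace Ω] [TopologicalSpace Ω]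
    [OpensMeasurableSpace Ω] [HasOuterApproxClosed Ω] [FirstCountableTopology (ProbabilityMeasure Ω)]
    {f : Ω → ℝ} (hf : UpperSemicontinuous f) {K : ℝ} (hK : ∀ x, f x ≤ K)
    (hint : ∀ ν : ProbabilityMeasure Ω, Integrable f (ν : Measure Ω)) :
    UpperSemicontinuous fun ν : ProbabilityMeasure Ω => ∫ x, f x ∂(ν : Measure Ω) := by
  have hg : LowerSemicontinuous fun x => K - f x :=
    (show Continuous fun y : ℝ => K - y by fun_prop).comp_upperSemicontinuous_antitone hf
      fun a b h => sub_le_sub_left h K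
  have hg0 : 0 ≤ fun x => K - f x := fun x => sub_nonneg.2 (hK x)
  have hl := lowerSemicontinuous_lintegral_ofReal hg hg0
  have heq : ∀ ν : ProbabilityMeasure Ω, ∫⁻ x, ENNReal.ofReal (K - f x) ∂(ν : Measure Ω) =
      ENNReal.ofReal (K - ∫ x, f x ∂(ν : Measure Ω)) := by
    intro ν
    have hi : Integrable (fun x => K - f x) (ν : Measure Ω) := (integrable_const K).sub (hint ν)
    rw [← ofReal_integral_eq_lintegral_ofReal hi
      (Eventually.of_forall hg0), integral_sub (integrable_const K) (hint ν)]
    simp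
  intro ν y hy
  change ∫ x, f x ∂(ν : Measure Ω) < y at hy
  have hle : ∀ ν : ProbabilityMeasure Ω, ∫ x, f x ∂(ν : Measure Ω) ≤ K := fun ν => by
    have := integral_mono (hint ν) (integrable_const K) hK
    simpa using this
  -- If `K < y`, truncation at `0` can destroy the strict inequality, but then the claim holds for
  -- every measure.
  have h1 : ENNReal.ofReal (K - y) < ∫⁻ x, ENNReal.ofReal (K - f x) ∂(ν : Measure Ω) ∨ K < y := by
    rw [heq]
    rcases lt_or_ge K y with h | h
    · exact Or.inr h
    · exact Or.inl ((ENNReal.ofReal_lt_ofReal_iff (by linarith)).2 (by linarith))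
  rcases h1 with h1 | h1
  · filter_upwards [hl ν _ h1] with ν' hν'
    change ENNReal.ofReal (K - y) < _ at hν'
    rw [heq] at hν'
    have := (ENNReal.lt_ofReal_iff_toReal_lt (by simp)).1 hν'
    change ∫ x, f x ∂(ν' : Measure Ω) < y
    have h3 := le_max_left (K - y) 0
    rw [ENNReal.toReal_ofReal'] at this
    linarith
  · exact Eventually.of_forall fun ν' => (hle ν').trans_lt h1

/-! ### Wages and existence of best responses. -/

namespace FlexMech

variable {X : Set ℝ}

/-- Right-continuity controls the points above `x`, monotonicity those below. -/
theorem IsWage.upperSemicontinuous {w : X → ℝ} (hw : IsWage w) : UpperSemicontinuous w := by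
  intro x y hy
  change w x < y at hy
  have h1 : ∀ᶠ z in 𝓝[>] x, w z < y := (hw.2 x).eventually (gt_mem_nhds hy)
  rw [eventually_nhdsWithin_iff] at h1
  filter_upwards [h1] with z hz
  rcases lt_or_ge x z with h | h
  · exact hz h
  · exact (hw.1 h).trans_lt hy

theorem IsWage.exists_bound [CompactSpace X] [Nonempty X] {w : X → ℝ} (hw : IsWage w) :
    ∃ a b, ∀ x, a ≤ w x ∧ w x ≤ b := by
  obtain ⟨x₀, -, h₀⟩ := isCompact_univ.exists_isMinOn (univ_nonempty (α := X))
    (continuous_subtype_val (p := (· ∈ X))).continuousOn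
  obtain ⟨x₁, -, h₁⟩ := isCompact_univ.exists_isMaxOn (univ_nonempty (α := X))
    (continuous_subtype_val (p := (· ∈ X))).continuousOn
  exact ⟨w x₀, w x₁, fun x => ⟨hw.1 (h₀ (mem_univ x)), hw.1 (h₁ (mem_univ x))⟩⟩

theorem IsWage.integrable_comp [CompactSpace X] [Nonempty X] {w : X → ℝ} (hw : IsWage w)
    {u : ℝ → ℝ} (hu : StrictMono u) (hc : Continuous u) (ν : ProbabilityMeasure X) :
    Integrable (fun x => u (w x)) (ν : Measure X) := by
  obtain ⟨a, b, hab⟩ := hw.exists_bound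
  refine Integrable.of_mem_Icc (u a) (u b)
    (hc.measurable.comp hw.upperSemicontinuous.measurable).aemeasurable
    (Eventually.of_forall fun x => ⟨hu.monotone (hab x).1, hu.monotone (hab x).2⟩)

/-- Every type has a best response to every wage. -/
theorem exists_forall_U_le [CompactSpace X] [Nonempty X] {u : ℝ → ℝ} (hu : StrictMono u)
    (hc : Continuous u) {C : ℝ → ProbabilityMeasure X → ℝ} {θ : ℝ} (hC : Continuous (C θ))
    {w : X → ℝ} (hw : IsWage w) : ∃ m, ∀ ν, U u C θ w ν ≤ U u C θ w m := by
  obtain ⟨a, b, hab⟩ := hw.exists_bound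
  have h1 : UpperSemicontinuous fun x => u (w x) :=
    hc.comp_upperSemicontinuous hw.upperSemicontinuous hu.monotone
  have h2 := upperSemicontinuous_integral h1 (fun x => hu.monotone (hab x).2)
    (hw.integrable_comp hu hc)
  have h3 : UpperSemicontinuous fun ν => U u C θ w ν := by
    simp only [U, sub_eq_add_neg]
    exact h2.add hC.neg.upperSemicontinuous
  have hne : Nonempty (ProbabilityMeasure X) :=
    ⟨⟨Measure.dirac (Classical.arbitrary X), inferInstance⟩⟩
  obtain ⟨m, -, hm⟩ := (h3.upperSemicontinuousOn univ).exists_isMaxOn univ_nonempty isCompact_univ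
  exact ⟨m, fun ν => hm (mem_univ ν)⟩

/-! ### Mixtures and the first-order condition. -/

theorem integral_mix {f : X → ℝ} {μ ν : ProbabilityMeasure X} (hμ : Integrable f (μ : Measure X))
    (hν : Integrable f (ν : Measure X)) (t : unitInterval) :
    ∫ x, f x ∂(mix t μ ν : Measure X) =
      (1 - (t : ℝ)) * ∫ x, f x ∂(μ : Measure X) + (t : ℝ) * ∫ x, f x ∂(ν : Measure X) := by
  have h0 : 0 ≤ (t : ℝ) := t.2.1
  have h1 : 0 ≤ 1 - (t : ℝ) := sub_nonneg.2 t.2.2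
  change ∫ x, f x ∂(ENNReal.ofReal (1 - (t : ℝ)) • (μ : Measure X) +
    ENNReal.ofReal (t : ℝ) • (ν : Measure X)) = _
  rw [integral_add_measure (hμ.smul_measure ENNReal.ofReal_ne_top)
    (hν.smul_measure ENNReal.ofReal_ne_top), integral_smul_measure, integral_smul_measure,
    ENNReal.toReal_ofReal h0, ENNReal.toReal_ofReal h1, smul_eq_mul, smul_eq_mul]

theorem neBot_nhdsGT_zero_unitInterval : (𝓝[>] (0 : unitInterval)).NeBot :=
  nhdsGT_neBot_of_exists_gt ⟨1, by simp⟩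

/-- The first-order condition for the maximization of a linear functional net of a convex, Gâteaux
differentiable cost. -/
theorem forall_integral_sub_le_iff [CompactSpace X] {K : ProbabilityMeasure X → ℝ}
    (hconv : ∀ (t : unitInterval) (μ ν : ProbabilityMeasure X),
      K (mix t μ ν) ≤ (1 - (t : ℝ)) * K μ + (t : ℝ) * K ν)
    {m : ProbabilityMeasure X} {c : C(X, ℝ)} (hc : IsGateauxDeriv K m c) {h : X → ℝ}
    (hint : ∀ ν : ProbabilityMeasure X, Integrable h (ν : Measure X)) :
    (∀ ν : ProbabilityMeasure X,
      (∫ x, h x ∂(ν : Measure X)) - K ν ≤ (∫ x, h x ∂(m : Measure X)) - K m) ↔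
    ∀ ν : ProbabilityMeasure X,
      ∫ x, (h x - c x) ∂(ν : Measure X) ≤ ∫ x, (h x - c x) ∂(m : Measure X) := by
  have := neBot_nhdsGT_zero_unitInterval
  have hcint : ∀ ν : ProbabilityMeasure X, Integrable c (ν : Measure X) := fun ν =>
    c.continuous.integrable_of_hasCompactSupport (HasCompactSupport.of_compactSpace _)
  have hpos : ∀ᶠ ε : unitInterval in 𝓝[>] 0, 0 < (ε : ℝ) := by
    filter_upwards [self_mem_nhdsWithin] with ε hε using hε
  simp only [integral_sub (hint _) (hcint _)]
  refine ⟨fun H ν => ?_, fun H ν => ?_⟩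
  · have : (∫ x, h x ∂(ν : Measure X)) - ∫ x, h x ∂(m : Measure X) ≤
        (∫ x, c x ∂(ν : Measure X)) - ∫ x, c x ∂(m : Measure X) := by
      refine ge_of_tendsto (hc ν) ?_
      filter_upwards [hpos] with ε hε
      rw [le_div_iff₀ hε]
      have := H (mix ε m ν)
      rw [integral_mix (hint m) (hint ν)] at this
      linarith
    linarith
  -- Convexity bounds every difference quotient by `K ν - K m`, so the linearization lies below `K`.
  · have : (∫ x, c x ∂(ν : Measure X)) - ∫ x, c x ∂(m : Measure X) ≤ K ν - K m := by
      refine le_of_tendsto (hc ν) ?_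
      filter_upwards [hpos] with ε hε
      rw [div_le_iff₀ hε]
      linarith [hconv ε m ν]
    linarith [H ν]

/-! ### The extended inverse of the utility. -/

/-- Expresses obedience in utilities, whether or not `y` is in the range of `u`. If `u r > y`, some
`s < r` still has `u s > y` and bounds the supremum. -/
theorem coe_le_extInv_iff {u : ℝ → ℝ} (hu : StrictMono u) (hc : Continuous u) {r y : ℝ} :
    (r : EReal) ≤ extInv u y ↔ u r ≤ y := by
  refine ⟨fun h => ?_, fun h => le_sSup ⟨r, h, rfl⟩⟩
  by_contra! hlt
  obtain ⟨s, hs, hsy⟩ := ((hc.continuousAt.eventually (lt_mem_nhds hlt)).filter_mono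
    (nhdsWithin_le_nhds (s := Iio r))).and self_mem_nhdsWithin |>.exists
  have : extInv u y ≤ (s : EReal) := by
    refine sSup_le ?_
    rintro _ ⟨q, hq, rfl⟩
    exact EReal.coe_le_coe_iff.2 (hu.le_iff_le.1 (le_trans hq hs.le))
  exact absurd (EReal.coe_le_coe_iff.1 (h.trans this)) (not_le.2 hsy)

theorem coe_eq_extInv_iff {u : ℝ → ℝ} (hu : StrictMono u) (hc : Continuous u) {r y : ℝ} :
    (r : EReal) = extInv u y ↔ u r = y := by
  constructor
  · intro h
    refine le_antisymm ((coe_le_extInv_iff hu hc).1 h.le) ?_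
    by_contra! hlt
    obtain ⟨s, hs, hsr⟩ := ((hc.continuousAt.eventually (gt_mem_nhds hlt)).filter_mono
      (nhdsWithin_le_nhds (s := Ioi r))).and self_mem_nhdsWithin |>.exists
    have := (coe_le_extInv_iff hu hc).2 hs.le
    rw [← h] at this
    exact absurd (EReal.coe_le_coe_iff.1 this) (not_le.2 hsr)
  · rintro rfl
    refine le_antisymm ((coe_le_extInv_iff hu hc).2 le_rfl) (sSup_le ?_)
    rintro _ ⟨q, hq, rfl⟩
    exact EReal.coe_le_coe_iff.2 (hu.le_iff_le.1 hq)

end FlexMech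

/-! ### Integral bounds from Dini derivatives. -/

/-- A continuous function increases by at most the integral of an integrable function that bounds
its upper right Dini derivative. -/
theorem sub_le_integral_of_forall_eventually_sub_le {g φ : ℝ → ℝ} {a b : ℝ} (hab : a ≤ b)
    (hcont : ContinuousOn g (Icc a b)) (φint : IntegrableOn φ (Icc a b))
    (hφ : ∀ t ∈ Ico a b, ∀ y, φ t < y → ∀ᶠ s in 𝓝[>] t, g s - g t ≤ (s - t) * y) :
    g b - g a ≤ ∫ y in a..b, φ y := by
  refine le_of_forall_pos_le_add fun ε εpos => ?_
  -- Vitali–Carathéodory: a lower semicontinuous `G' > φ` whose integral exceeds that of `φ` by less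
  -- than `ε`. Near `t` it stays above some `y > φ t`, so the inequality propagates to the right
  -- along a closed set.
  rcases exists_lt_lowerSemicontinuous_integral_lt φ φint εpos with
    ⟨G', f_lt_G', G'cont, G'int, G'lt_top, hG'⟩
  set s := {t | g t - g a ≤ ∫ u in a..t, (G' u).toReal} ∩ Icc a b
  have s_closed : IsClosed s := by
    have : ContinuousOn (fun t => (g t - g a, ∫ u in a..t, (G' u).toReal)) (Icc a b) := by
      rw [← uIcc_of_le hab] at G'int hcont ⊢
      exact (hcont.sub continuousOn_const).prodMk
        (intervalIntegral.continuousOn_primitive_interval G'int)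
    simp only [s, inter_comm]
    exact this.preimage_isClosed_of_isClosed isClosed_Icc OrderClosedTopology.isClosed_le'
  have main : Icc a b ⊆ {t | g t - g a ≤ ∫ u in a..t, (G' u).toReal} := by
    refine s_closed.Icc_subset_of_forall_exists_gt
      (by simp) fun t ht v t_lt_v => ?_
    obtain ⟨y, φ_lt_y, y_lt_G'⟩ : ∃ y : ℝ, (φ t : EReal) < y ∧ (y : EReal) < G' t :=
      EReal.lt_iff_exists_real_btwn.1 (f_lt_G' t)
    have I1 : ∀ᶠ u in 𝓝[>] t, (u - t) * y ≤ ∫ w in t..u, (G' w).toReal := by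
      have B : ∀ᶠ u in 𝓝 t, (y : EReal) < G' u := G'cont.lowerSemicontinuousAt _ _ y_lt_G'
      rcases mem_nhds_iff_exists_Ioo_subset.1 B with ⟨m, M, ⟨hm, hM⟩, H⟩
      have : Ioo t (min M b) ∈ 𝓝[>] t := Ioo_mem_nhdsGT (lt_min hM ht.right.right)
      filter_upwards [this] with u hu
      have I : Icc t u ⊆ Icc a b := Icc_subset_Icc ht.2.1 (hu.2.le.trans (min_le_right _ _))
      calc
        (u - t) * y = ∫ _ in Icc t u, y := by
          simp only [MeasureTheory.integral_const, MeasurableSet.univ, measureReal_restrict_apply,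
            univ_inter, hu.left.le, Real.volume_real_Icc_of_le, smul_eq_mul]
        _ ≤ ∫ w in t..u, (G' w).toReal := by
          rw [intervalIntegral.integral_of_le hu.1.le, ← integral_Icc_eq_integral_Ioc]
          apply setIntegral_mono_ae_restrict
          · simp
          · exact IntegrableOn.mono_set G'int I
          · have C1 : ∀ᵐ x : ℝ ∂volume.restrict (Icc t u), G' x < ⊤ :=
              ae_mono (Measure.restrict_mono I le_rfl) G'lt_top
            have C2 : ∀ᵐ x : ℝ ∂volume.restrict (Icc t u), x ∈ Icc t u :=
              ae_restrict_mem measurableSet_Icc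
            filter_upwards [C1, C2] with x G'x hx
            apply EReal.coe_le_coe_iff.1
            have : x ∈ Ioo m M := by
              simp only [hm.trans_le hx.left,
                (hx.right.trans_lt hu.right).trans_le (min_le_left M b), mem_Ioo, and_self_iff]
            refine (H this).out.le.trans_eq ?_
            exact (EReal.coe_toReal G'x.ne (f_lt_G' x).ne_bot).symm
    have I2 : ∀ᶠ u in 𝓝[>] t, g u - g t ≤ (u - t) * y := hφ t ht.2 y (EReal.coe_lt_coe_iff.1 φ_lt_y)
    have I3 : ∀ᶠ u in 𝓝[>] t, g u - g t ≤ ∫ w in t..u, (G' w).toReal := by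
      filter_upwards [I1, I2] with u hu1 hu2 using hu2.trans hu1
    have I4 : ∀ᶠ u in 𝓝[>] t, u ∈ Ioc t (min v b) := Ioc_mem_nhdsGT <| lt_min t_lt_v ht.2.2
    rcases (I3.and I4).exists with ⟨x, hx, h'x⟩
    refine ⟨x, ?_, Ioc_subset_Ioc le_rfl (min_le_left _ _) h'x⟩
    calc
      g x - g a = g t - g a + (g x - g t) := by abel
      _ ≤ (∫ w in a..t, (G' w).toReal) + ∫ w in t..x, (G' w).toReal := add_le_add ht.1 hx
      _ = ∫ w in a..x, (G' w).toReal := by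
        apply intervalIntegral.integral_add_adjacent_intervals
        · rw [intervalIntegrable_iff_integrableOn_Ioc_of_le ht.2.1]
          exact IntegrableOn.mono_set G'int
            (Ioc_subset_Icc_self.trans (Icc_subset_Icc le_rfl ht.2.2.le))
        · rw [intervalIntegrable_iff_integrableOn_Ioc_of_le h'x.1.le]
          apply IntegrableOn.mono_set G'int
          exact Ioc_subset_Icc_self.trans (Icc_subset_Icc ht.2.1 (h'x.2.trans (min_le_right _ _)))
  calc
    g b - g a ≤ ∫ y in a..b, (G' y).toReal := main (right_mem_Icc.2 hab)
    _ ≤ (∫ y in a..b, φ y) + ε := by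
      convert! hG'.le <;>
        · rw [intervalIntegral.integral_of_le hab]
          rw [integral_Icc_eq_integral_Ioc]

/-- A continuous function increases by at most the integral of an integrable function that bounds
its upper left Dini derivative. -/
theorem sub_le_integral_of_forall_eventually_sub_le_left {g φ : ℝ → ℝ} {a b : ℝ} (hab : a ≤ b)
    (hcont : ContinuousOn g (Icc a b)) (φint : IntegrableOn φ (Icc a b))
    (hφ : ∀ t ∈ Ioc a b, ∀ y, φ t < y → ∀ᶠ s in 𝓝[<] t, g t - g s ≤ (t - s) * y) :
    g b - g a ≤ ∫ y in a..b, φ y := by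
  -- This reflection exchanges left and right Dini derivatives.
  have h := sub_le_integral_of_forall_eventually_sub_le (g := fun x => -g (-x))
    (φ := fun x => φ (-x)) (neg_le_neg hab) ?_ ?_ ?_
  · rw [intervalIntegral.integral_comp_neg] at h
    simp only [neg_neg] at h
    linarith
  · refine (hcont.comp continuous_neg.continuousOn fun x hx => ?_).neg
    exact ⟨by linarith [hx.2], by linarith [hx.1]⟩
  · have h := (intervalIntegrable_iff_integrableOn_Icc_of_le hab).2 φint
    have h' := (IntervalIntegrable.iff_comp_neg (by simp)).1 h.symm
    exact (intervalIntegrable_iff_integrableOn_Icc_of_le (neg_le_neg hab)).1 h'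
  · intro t ht y hy
    have := hφ (-t) ⟨by linarith [ht.2], by linarith [ht.1]⟩ y hy
    have h2 : Tendsto (fun s : ℝ => -s) (𝓝[>] t) (𝓝[<] (-t)) := tendsto_neg_nhdsGT
    filter_upwards [h2.eventually this] with s hs
    linarith

/-! ### Joint continuity and the abstract envelope theorem. -/

/-- A function that is continuous in each variable and antitone in the first is jointly
continuous. -/
theorem continuous_uncurry_of_antitone {Y : Type*} [TopologicalSpace Y] {F : ℝ → Y → ℝ}
    (hleft : ∀ y, Continuous fun t => F t y) (hright : ∀ t, Continuous (F t))
    (hanti : ∀ y, Antitone fun t => F t y) : Continuous fun p : ℝ × Y => F p.1 p.2 := by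
  refine continuous_iff_continuousAt.2 fun ⟨s, y⟩ => tendsto_order.2 ⟨fun z hz => ?_, fun z hz => ?_⟩
  -- One `t > s` with `F t y > z` suffices: for first coordinates below `t`, `F` is at least `F t`,
  -- and only continuity of `F t` is needed.
  · obtain ⟨t, ht, hst⟩ := ((((hleft y).continuousAt.eventually (lt_mem_nhds hz))).filter_mono
      (nhdsWithin_le_nhds (s := Ioi s))).and self_mem_nhdsWithin |>.exists
    filter_upwards [prod_mem_nhds (gt_mem_nhds hst)
      ((hright t).continuousAt.eventually (lt_mem_nhds ht))] with p hp
    exact lt_of_lt_of_le hp.2 (hanti p.2 (le_of_lt hp.1))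
  · obtain ⟨t, ht, hst⟩ := ((((hleft y).continuousAt.eventually (gt_mem_nhds hz))).filter_mono
      (nhdsWithin_le_nhds (s := Iio s))).and self_mem_nhdsWithin |>.exists
    filter_upwards [prod_mem_nhds (lt_mem_nhds hst)
      ((hright t).continuousAt.eventually (gt_mem_nhds ht))] with p hp
    exact lt_of_le_of_lt (hanti p.2 (le_of_lt hp.1)) hp.2

/-- The envelope theorem for continuous values, where `f t` is the cost, as a function of the
parameter, of an action that is optimal at `t`. -/
theorem envelope_of_continuousOn {lo hi : ℝ} {f : ℝ → ℝ → ℝ} {V : ℝ → ℝ}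
    (hdiff : ∀ t, DifferentiableOn ℝ (f t) (Icc lo hi))
    (hanti : ∀ t, AntitoneOn (f t) (Icc lo hi))
    (hopt : ∀ s ∈ Icc lo hi, ∀ t ∈ Icc lo hi, V t - V s ≤ f t s - f t t)
    (hcont : ContinuousOn V (Icc lo hi)) {s t : ℝ} (hs : s ∈ Icc lo hi) (ht : t ∈ Icc lo hi) :
    IntervalIntegrable (fun r => derivWithin (f r) (Icc lo hi) r) volume s t ∧
      V t - V s = -∫ r in s..t, derivWithin (f r) (Icc lo hi) r := by
  wlog hst : s ≤ t generalizing s t with h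
  · obtain ⟨h1, h2⟩ := h ht hs (le_of_not_ge hst)
    refine ⟨h1.symm, ?_⟩
    rw [intervalIntegral.integral_symm]
    linarith
  have hsub : Icc s t ⊆ Icc lo hi := Icc_subset_Icc hs.1 ht.2
  have hmono : MonotoneOn V (uIcc s t) := by
    rw [uIcc_of_le hst]
    intro a ha b hb hab
    linarith [hopt b (hsub hb) a (hsub ha), hanti a (hsub ha) (hsub hb) hab]
  have hae : ∀ᵐ r, r ∈ uIoc s t → deriv V r = -derivWithin (f r) (Icc lo hi) r := by
    rw [uIcc_of_le hst] at hmono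
    have hne : ∀ᵐ r : ℝ, r ≠ t := by simp [ae_iff]
    filter_upwards [hmono.ae_differentiableWithinAt_of_mem, hne] with r hr hrt hmem
    rw [uIoc_of_le hst] at hmem
    have hrs : r ∈ Ioo s t := ⟨hmem.1, lt_of_le_of_ne hmem.2 hrt⟩
    have hN : Icc s t ∈ 𝓝 r := Icc_mem_nhds hrs.1 hrs.2
    have hN' : Icc lo hi ∈ 𝓝 r := mem_of_superset hN hsub
    have hrI : r ∈ Icc lo hi := mem_of_mem_nhds hN'
    have h1 := ((hr (Ioo_subset_Icc_self hrs)).differentiableAt hN).hasDerivAt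
    have h2 := ((hdiff r r hrI).differentiableAt hN').hasDerivAt
    -- Type `x` can imitate `r`, so `V + f r` is minimal at `r`.
    have h3 : IsLocalMin (fun x => V x + f r x) r := by
      filter_upwards [hN'] with x hx
      linarith [hopt x hx r hrI]
    have h4 := h3.hasDerivAt_eq_zero (h1.add h2)
    rw [derivWithin_of_mem_nhds hN']
    linarith
  have hint : IntervalIntegrable (fun r => -derivWithin (f r) (Icc lo hi) r) volume s t :=
    hmono.intervalIntegrable_deriv.congr_ae ((ae_restrict_iff' measurableSet_uIoc).2 hae)
  refine ⟨by simpa [Pi.neg_def] using hint.neg, ?_⟩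
  rw [← intervalIntegral.integral_neg]
  refine le_antisymm ?_ ?_
  -- The left Dini bound comes from `hopt` at every point, not just almost everywhere; this rules
  -- out Cantor-type growth. The reverse inequality is Lebesgue's for monotone functions.
  · refine sub_le_integral_of_forall_eventually_sub_le_left hst (hcont.mono hsub)
      ((intervalIntegrable_iff_integrableOn_Icc_of_le hst).1 hint) fun τ hτ y hy => ?_
    have hτI : τ ∈ Icc lo hi := hsub (Ioc_subset_Icc_self hτ)
    have hN : Icc s t ∈ 𝓝[<] τ := mem_of_superset (Ioo_mem_nhdsLT hτ.1) fun r hr =>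
      ⟨hr.1.le, hr.2.le.trans hτ.2⟩
    have hd : HasDerivWithinAt (f τ) (derivWithin (f τ) (Icc lo hi) τ) (Iio τ) τ :=
      (hdiff τ τ hτI).hasDerivWithinAt.mono_of_mem_nhdsWithin (mem_of_superset hN hsub)
    rw [hasDerivWithinAt_iff_tendsto_slope' (by simp)] at hd
    filter_upwards [hd.eventually (lt_mem_nhds (show -y < _ by linarith)), hN,
      self_mem_nhdsWithin] with r hr hrI hrτ
    have hrτ' : r - τ < 0 := sub_neg.2 hrτ
    rw [slope_def_field, lt_div_iff_of_neg hrτ'] at hr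
    linarith [hopt r (hsub hrI) τ hτI]
  · rw [← intervalIntegral.integral_congr_ae hae]
    have h := hmono.intervalIntegral_deriv_mem_uIcc
    rw [uIcc_of_le (sub_nonneg.2 (hmono (by simp) (by simp) hst))] at h
    exact h.2

/-! ### Envelope, obedience and misreporting losses for the cost. -/

namespace FlexMech

variable {X : Set ℝ}

/-- Joint continuity plus compactness of the space of distributions gives uniformity in `ν`, from
which continuity of the value follows. -/
theorem IsCost.eventually_abs_sub_lt [CompactSpace X] {lo hi : ℝ} (hΘ : lo ≤ hi)
    {C : ℝ → ProbabilityMeasure X → ℝ} {c : ℝ → ProbabilityMeasure X → C(X, ℝ)}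
    (hC : IsCost lo hi C c) {s : ℝ} (hs : s ∈ Icc lo hi) {ε : ℝ} (hε : 0 < ε) :
    ∀ᶠ t in 𝓝[Icc lo hi] s, ∀ ν, |C t ν - C s ν| < ε := by
  have hcont : Continuous fun p : ℝ × ProbabilityMeasure X => C (projIcc lo hi hΘ p.1) p.2 :=
    continuous_uncurry_of_antitone
      (fun ν => (hC.contDiff ν).continuousOn.comp_continuous
        (continuous_subtype_val.comp continuous_projIcc) fun t => (projIcc lo hi hΘ t).2)
      (fun t => hC.continuous _ (projIcc lo hi hΘ t).2)
      fun ν a b hab => (hC.strictAnti ν).antitoneOn (projIcc lo hi hΘ a).2 (projIcc lo hi hΘ b).2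
        (monotone_projIcc hΘ hab)
  have h : ∀ᶠ t in 𝓝 s, ∀ ν ∈ univ,
      |C (projIcc lo hi hΘ t) ν - C (projIcc lo hi hΘ s) ν| < ε := by
    refine isCompact_univ.eventually_forall_of_forall_eventually fun ν _ => ?_
    have h2 : Continuous fun p : ℝ × ProbabilityMeasure X =>
        |C (projIcc lo hi hΘ p.1) p.2 - C (projIcc lo hi hΘ s) p.2| :=
      (hcont.sub (hcont.comp (continuous_const.prodMk continuous_snd))).abs
    exact h2.continuousAt.eventually (gt_mem_nhds (by simpa using hε))
  filter_upwards [h.filter_mono nhdsWithin_le_nhds, self_mem_nhdsWithin] with t ht htI ν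
  simpa [projIcc_of_mem hΘ htI, projIcc_of_mem hΘ hs] using ht ν (mem_univ ν)

/-- The envelope theorem: the value `V` that is attained by the actions `m` satisfies the envelope
formula. -/
theorem IsCost.envelope [CompactSpace X] {lo hi : ℝ} (hΘ : lo ≤ hi)
    {C : ℝ → ProbabilityMeasure X → ℝ} {c : ℝ → ProbabilityMeasure X → C(X, ℝ)}
    (hC : IsCost lo hi C c) {m : ℝ → ProbabilityMeasure X} {V : ℝ → ℝ}
    (hopt : ∀ s ∈ Icc lo hi, ∀ t ∈ Icc lo hi, V t - V s ≤ C s (m t) - C t (m t))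
    {s t : ℝ} (hs : s ∈ Icc lo hi) (ht : t ∈ Icc lo hi) :
    IntervalIntegrable (fun r => dCost lo hi C r (m r)) volume s t ∧
      V t - V s = -∫ r in s..t, dCost lo hi C r (m r) := by
  refine envelope_of_continuousOn (f := fun t r => C r (m t))
    (fun t => (hC.contDiff (m t)).differentiableOn one_ne_zero)
    (fun t => (hC.strictAnti (m t)).antitoneOn) hopt ?_ hs ht
  intro s hs
  refine Metric.tendsto_nhds.2 fun ε hε => ?_
  filter_upwards [hC.eventually_abs_sub_lt hΘ hs hε, self_mem_nhdsWithin] with t ht htI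
  rw [Real.dist_eq, abs_lt]
  have h1 := abs_lt.1 (ht (m t))
  have h2 := abs_lt.1 (ht (m s))
  constructor
  · linarith [hopt t htI s hs]
  · linarith [hopt s hs t htI]

/-- Type `s` can copy both report and action of `t`; the wage terms then cancel. -/
theorem IncentiveCompatible.sub_le {lo hi : ℝ} {u : ℝ → ℝ} {C : ℝ → ProbabilityMeasure X → ℝ}
    {w : ℝ → X → ℝ} {μ : ℝ → ProbabilityMeasure X} (h : IncentiveCompatible lo hi u C w μ)
    {s t : ℝ} (hs : s ∈ Icc lo hi) (ht : t ∈ Icc lo hi) :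
    U u C t (w t) (μ t) - U u C s (w s) (μ s) ≤ C s (μ t) - C t (μ t) := by
  have := h s hs t ht (μ t)
  simp only [U] at this ⊢
  linarith

/-- On-path obedience says that the recommended action is a best response. -/
theorem onPathObedience_iff [CompactSpace X] [Nonempty X] {lo hi : ℝ} {u : ℝ → ℝ}
    (hu : StrictMono u) (hc : Continuous u) {C : ℝ → ProbabilityMeasure X → ℝ}
    {c : ℝ → ProbabilityMeasure X → C(X, ℝ)} (hC : IsCost lo hi C c) {w : ℝ → X → ℝ}
    {μ : ℝ → ProbabilityMeasure X} {V : ℝ → ℝ} {θ : ℝ} (hθ : θ ∈ Icc lo hi) (hw : IsWage (w θ))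
    (hV : V θ = U u C θ (w θ) (μ θ)) :
    OnPathObedience u C c w μ V θ ↔ ∀ ν, U u C θ (w θ) ν ≤ U u C θ (w θ) (μ θ) := by
  have hint := hw.integrable_comp hu hc
  have hcint : ∀ ν : ProbabilityMeasure X, Integrable (c θ (μ θ)) (ν : Measure X) := fun ν =>
    (c θ (μ θ)).continuous.integrable_of_hasCompactSupport (HasCompactSupport.of_compactSpace _)
  have hd : ∀ ν : ProbabilityMeasure X,
      Integrable (fun x => u (w θ x) - c θ (μ θ) x) (ν : Measure X) := fun ν =>
    (hint ν).sub (hcint ν)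
  -- Inserting `V` cancels the cost and leaves `c` plus a constant, the value of the linearized
  -- problem.
  have hlevel : ∀ x, obedienceLevel C c μ V θ x =
      c θ (μ θ) x + ∫ y, (u (w θ y) - c θ (μ θ) y) ∂(μ θ : Measure X) := by
    intro x
    rw [integral_sub (hint _) (hcint _), obedienceLevel, hV, U]
    ring
  simp only [OnPathObedience, coe_le_extInv_iff hu hc, coe_eq_extInv_iff hu hc, hlevel]
  refine Iff.trans ?_ (forall_integral_sub_le_iff (hC.convex θ hθ) (hC.gateaux θ hθ (μ θ))
    hint).symm
  set I := ∫ y, (u (w θ y) - c θ (μ θ) y) ∂(μ θ : Measure X) with hI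
  constructor
  · rintro ⟨hle, -⟩ ν
    have := integral_mono (hd ν) (integrable_const I) fun x => by
      change u (w θ x) - c θ (μ θ) x ≤ I
      linarith [hle x]
    simpa using this
  · intro hle
    have hpt : ∀ x : X, u (w θ x) - c θ (μ θ) x ≤ I := fun x => by
      have := hle ⟨Measure.dirac x, inferInstance⟩
      simpa using this
    refine ⟨fun x => by linarith [hpt x], ?_⟩
    -- A nonnegative gap with zero integral vanishes almost everywhere.
    have h0 : ∫ x, (I - (u (w θ x) - c θ (μ θ) x)) ∂(μ θ : Measure X) = 0 := by
      rw [integral_sub (integrable_const I) (hd _)]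
      simp [hI]
    have hi : Integrable (fun x => I - (u (w θ x) - c θ (μ θ) x)) (μ θ : Measure X) :=
      (integrable_const I).sub (hd _)
    filter_upwards [(integral_eq_zero_iff_of_nonneg (fun x => sub_nonneg.2 (hpt x)) hi).1 h0]
      with x hx
    have : I - (u (w θ x) - c θ (μ θ) x) = 0 := hx
    linarith

/-- When every type best responds to the wage `w θ'`, the integral in generalized monotonicity is
the loss of type `θ` from the report `θ'`. -/
theorem IsCost.integral_eq_loss [CompactSpace X] {lo hi : ℝ} (hΘ : lo ≤ hi) {u : ℝ → ℝ}
    {C : ℝ → ProbabilityMeasure X → ℝ} {c : ℝ → ProbabilityMeasure X → C(X, ℝ)}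
    (hC : IsCost lo hi C c) {w : ℝ → X → ℝ} {μ : ℝ → ProbabilityMeasure X}
    {M : ℝ → ℝ → ProbabilityMeasure X} {θ θ' : ℝ} (hθ : θ ∈ Icc lo hi) (hθ' : θ' ∈ Icc lo hi)
    (hMμ : M θ' θ' = μ θ')
    (hM : ∀ t ∈ Icc lo hi, ∀ ν, U u C t (w θ') ν ≤ U u C t (w θ') (M t θ'))
    (hint : IntervalIntegrable (fun t => dCost lo hi C t (μ t)) volume θ' θ)
    (henv : U u C θ (w θ) (μ θ) - U u C θ' (w θ') (μ θ') =
      -∫ t in θ'..θ, dCost lo hi C t (μ t)) :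
    IntervalIntegrable (fun t => -dCost lo hi C t (μ t) + dCost lo hi C t (M t θ')) volume θ' θ ∧
      ∫ t in θ'..θ, (-dCost lo hi C t (μ t) + dCost lo hi C t (M t θ')) =
        U u C θ (w θ) (μ θ) - U u C θ (w θ') (M θ θ') := by
  obtain ⟨h1, h2⟩ := hC.envelope hΘ (m := fun t => M t θ')
    (V := fun t => U u C t (w θ') (M t θ')) (fun s hs t ht => by
      have := hM s hs (M t θ')
      simp only [U] at this ⊢
      linarith) hθ' hθ
  refine ⟨hint.neg.add h1, ?_⟩
  have h3 : ∫ t in θ'..θ, (-dCost lo hi C t (μ t) + dCost lo hi C t (M t θ')) =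
      (∫ t in θ'..θ, -dCost lo hi C t (μ t)) + ∫ t in θ'..θ, dCost lo hi C t (M t θ') :=
    intervalIntegral.integral_add hint.neg h1
  rw [h3, intervalIntegral.integral_neg, ← henv]
  simp only [hMμ] at h2
  linarith

end FlexMech

/-! ### The characterization. -/

theorem theorem1 (X : Set ℝ) (hX : IsCompact X) (hXne : X.Nonempty)
    (lo hi : ℝ) (hΘ : lo ≤ hi)
    (u : ℝ → ℝ) (hu_mono : StrictMono u) (hu_cont : Continuous u)
    (hu_conc : ConcaveOn ℝ Set.univ u)
    (C : ℝ → ProbabilityMeasure X → ℝ) (c : ℝ → ProbabilityMeasure X → C(X, ℝ))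
    (hC : FlexMech.IsCost lo hi C c)
    (w : ℝ → X → ℝ) (hw : ∀ θ ∈ Icc lo hi, FlexMech.IsWage (w θ)) :
    -- after every report, every type has a best response
    (∀ θ ∈ Icc lo hi, ∀ θ' ∈ Icc lo hi, ∃ μ' : ProbabilityMeasure X,
      ∀ ν : ProbabilityMeasure X,
        FlexMech.U u C θ (w θ') ν ≤ FlexMech.U u C θ (w θ') μ') ∧
    -- the characterization of incentive compatibility
    ∀ μ : ℝ → ProbabilityMeasure X,
      (FlexMech.IncentiveCompatible lo hi u C w μ ↔
        ∃ (M : ℝ → ℝ → ProbabilityMeasure X) (V : ℝ → ℝ),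
          (∀ θ ∈ Icc lo hi, M θ θ = μ θ) ∧
          AbsolutelyContinuousOnInterval V lo hi ∧
          ∀ θ ∈ Icc lo hi,
            V θ = FlexMech.U u C θ (w θ) (μ θ) ∧
            FlexMech.Envelope lo hi C μ V θ ∧
            FlexMech.GenMonotone lo hi C μ M θ ∧
            FlexMech.OnPathObedience u C c w μ V θ ∧
            FlexMech.OffPathObedience lo hi u c w M θ) := by
  have := isCompact_iff_compactSpace.1 hX
  have := hXne.to_subtype
  have hbest : ∀ θ ∈ Icc lo hi, ∀ θ' ∈ Icc lo hi, ∃ μ' : ProbabilityMeasure X,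
      ∀ ν : ProbabilityMeasure X, FlexMech.U u C θ (w θ') ν ≤ FlexMech.U u C θ (w θ') μ' :=
    fun θ hθ θ' hθ' =>
      FlexMech.exists_forall_U_le hu_mono hu_cont (hC.continuous θ hθ) (hw θ' hθ')
  have hfoc : ∀ θ ∈ Icc lo hi, ∀ θ' ∈ Icc lo hi, ∀ m,
      (∀ ν, FlexMech.U u C θ (w θ') ν ≤ FlexMech.U u C θ (w θ') m) ↔
      ∀ ν : ProbabilityMeasure X, ∫ x, (u (w θ' x) - c θ m x) ∂(ν : Measure X) ≤
        ∫ x, (u (w θ' x) - c θ m x) ∂(m : Measure X) := fun θ hθ θ' hθ' m =>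
    FlexMech.forall_integral_sub_le_iff (hC.convex θ hθ) (hC.gateaux θ hθ m)
      ((hw θ' hθ').integrable_comp hu_mono hu_cont)
  have hlo : lo ∈ Icc lo hi := left_mem_Icc.2 hΘ
  have hhi : hi ∈ Icc lo hi := right_mem_Icc.2 hΘ
  refine ⟨hbest, fun μ => ⟨fun hIC => ?_, ?_⟩⟩
  · have henv := fun s hs t ht => hC.envelope hΘ
      (V := fun t => FlexMech.U u C t (w t) (μ t)) (fun s hs t ht => hIC.sub_le hs ht)
      (s := s) (t := t) hs ht
    -- Best responses need not be unique, so the diagonal is fixed to `μ t` before choosing.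
    have hresp : ∀ t s, ∃ m, t ∈ Icc lo hi → s ∈ Icc lo hi →
        (t = s → m = μ t) ∧ ∀ ν, FlexMech.U u C t (w s) ν ≤ FlexMech.U u C t (w s) m := by
      intro t s
      rcases eq_or_ne t s with rfl | hts
      · exact ⟨μ t, fun ht _ => ⟨fun _ => rfl, hIC t ht t ht⟩⟩
      · by_cases h : t ∈ Icc lo hi ∧ s ∈ Icc lo hi
        · obtain ⟨m, hm⟩ := hbest t h.1 s h.2
          exact ⟨m, fun _ _ => ⟨fun h => absurd h hts, hm⟩⟩
        · exact ⟨μ t, fun ht hs => absurd ⟨ht, hs⟩ h⟩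
    choose M hM using hresp
    -- As a primitive, `V` is absolutely continuous up to `hi`; `henv` identifies it with the
    -- truthful utility.
    let V : ℝ → ℝ := fun θ => FlexMech.U u C lo (w lo) (μ lo) -
      ∫ t in lo..θ, FlexMech.dCost lo hi C t (μ t)
    have hV : ∀ θ ∈ Icc lo hi, V θ = FlexMech.U u C θ (w θ) (μ θ) := fun θ hθ => by
      have := (henv lo hlo θ hθ).2
      simp only [V]
      linarith
    refine ⟨M, V, fun θ hθ => (hM θ θ hθ hθ).1 rfl, ?_, fun θ hθ => ⟨hV θ hθ, ?_, ?_, ?_, ?_⟩⟩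
    · have h := (henv lo hlo hi hhi).1.absolutelyContinuousOnInterval_intervalIntegral
        (c := lo) left_mem_uIcc
      have hconst : AbsolutelyContinuousOnInterval
          (fun _ : ℝ => FlexMech.U u C lo (w lo) (μ lo)) lo hi := by
        simpa [AbsolutelyContinuousOnInterval] using tendsto_const_nhds
      exact hconst.sub h
    · exact ⟨(henv lo hlo θ hθ).1, by simp [V]⟩
    · intro θ' hθ'
      obtain ⟨h1, h2⟩ := hC.integral_eq_loss hΘ hθ hθ' ((hM θ' θ' hθ' hθ').1 rfl)
        (fun t ht => (hM t θ' ht hθ').2) (henv θ' hθ' θ hθ).1 (henv θ' hθ' θ hθ).2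
      exact ⟨h1, h2 ▸ sub_nonneg.2 (hIC θ hθ θ' hθ' _)⟩
    · exact (FlexMech.onPathObedience_iff hu_mono hu_cont hC hθ (hw θ hθ) (hV θ hθ)).2
        (hIC θ hθ θ hθ)
    · exact fun θ' hθ' _ => (hfoc θ hθ θ' hθ' _).1 (hM θ θ' hθ hθ').2
  · rintro ⟨M, V, hMμ, -, hall⟩ θ hθ θ' hθ' ν
    have hM : ∀ t ∈ Icc lo hi, ∀ ν,
        FlexMech.U u C t (w θ') ν ≤ FlexMech.U u C t (w θ') (M t θ') := by
      intro t ht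
      obtain ⟨hV, -, -, hon, hoff⟩ := hall t ht
      rcases eq_or_ne θ' t with rfl | hne
      · rw [hMμ θ' hθ']
        exact (FlexMech.onPathObedience_iff hu_mono hu_cont hC ht (hw θ' ht) hV).1 hon
      · exact (hfoc t ht θ' hθ' _).2 (hoff θ' hθ' hne)
    obtain ⟨hVθ, ⟨hi1, he1⟩, hgm, -⟩ := hall θ hθ
    obtain ⟨hVθ', ⟨hi2, he2⟩, -⟩ := hall θ' hθ'
    have hadd := intervalIntegral.integral_add_adjacent_intervals hi2 (hi2.symm.trans hi1)
    have h := (hC.integral_eq_loss hΘ hθ hθ' (hMμ θ' hθ') hM (hi2.symm.trans hi1)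
      (by rw [← hVθ, ← hVθ']; linarith)).2
    -- Any deviation is worth at most the best response to `w θ'`, which by `hgm` is worth at most
    -- truth-telling.
    linarith [hM θ hθ ν, (hgm θ' hθ').2]
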